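/- **Theorem.** Let $n,m,d\ge 0$ be integers, let $\mathsf{Ext}=\{f_s:[2^n]\to[2^m]\}_{s\in[2^d]}$ be a family of functions, and let $k\le n$ be a real number. Let $$\mathrm{Err}(\mathsf{Ext},k):=\sup\ \frac1{2^d}\sum_{i,s,j}\Big[\delta_{f_s(i)=j}-\frac1{2^m}\Big]z_i\,y_{(s,j)},$$ where $i\in[2^n]$, $s\in[2^d]$, $j\in[2^m]$, and the supremum is over real $z_i,y_{(s,j)}$ with $0\le z_i\le 2^{-k}$, $\sum_i z_i=1$ and $0\le y_{(s,j)}\le 1$. Let $$\mathrm{Err}^{\overline{\mathrm{sdp}}_1}(\mathsf{Ext},k):=\sup\ \frac1{2^d}\sum_{i,s,j}\Big[\delta_{f_s(i)=j}-\frac1{2^m}\Big]\Omega_{(i),(s,j)},$$ where the supremum is over all positive semidefinite matrices $\Omega$ of size $1+2^n+2^{d+m}$, with rows and columns indexed by the words $w$ of length at most one (the empty word $\emptyset$, the words $(i)$ and the words $(s,j)$), such that for all $w,w',i,s,j$ $$\Omega_{w,w'}\ge 0,\quad \Omega_{\emptyset,\emptyset}=1,\quad \Omega_{\emptyset,w}=\sum_{i'}\Omega_{(i'),w},\quad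 2^{-k}\,\Omega_{\emptyset,w}\ge\Omega_{(i),w},\quad \Omega_{\emptyset,w}\ge\Omega_{(s,j),w}.$$ Then $$\mathrm{Err}^{\overline{\mathrm{sdp}}_1}(\mathsf{Ext},k)\le\sqrt2\,\sqrt{2^m}\,\sqrt{\mathrm{Err}(\mathsf{Ext},k)}$$ and $$\mathrm{Err}^{\overline{\mathrm{sdp}}_1}(\mathsf{Ext},k)\le 6\,K_G\,2^{n-k}\,\mathrm{Err}(\mathsf{Ext},k-1),$$ where $K_G$ is the (real) Grothendieck constant, i.e. the least $K$ such that for every real $p\times q$ matrix $A$ and all vectors $\vec a_i,\vec b_j$ of norm at most $1$ in a Euclidean space of any finite dimension, $\sum_{i,j}A_{ij}\,\vec a_i\cdot\vec b_j\le K\max\{\sum_{i,j}A_{ij}a_ib_j: a_i,b_j\in[-1,1]\}$. -/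

import Mathlib

noncomputable section

namespace QProofExtractor

/-! ### Grothendieck's constant -/

/-- `max { ∑ A i j * a i * b j : |a i| ≤ 1, |b j| ≤ 1 }` for a real matrix `A`. -/
def scalarMax {p q : ℕ} (A : Matrix (Fin p) (Fin q) ℝ) : ℝ :=
  sSup {t : ℝ | ∃ (a : Fin p → ℝ) (b : Fin q → ℝ),
    (∀ i, |a i| ≤ 1) ∧ (∀ j, |b j| ≤ 1) ∧ t = ∑ i, ∑ j, A i j * (a i * b j)}

/-- The real Grothendieck inequality holds with constant `K`, for all real matrices and all
families of vectors in the unit ball of a Euclidean space of arbitrary finite dimension. -/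
def GrothendieckInequality (K : ℝ) : Prop :=
  ∀ (p q : ℕ) (A : Matrix (Fin p) (Fin q) ℝ) (r : ℕ)
    (x : Fin p → EuclideanSpace ℝ (Fin r)) (y : Fin q → EuclideanSpace ℝ (Fin r)),
    (∀ i, ‖x i‖ ≤ 1) → (∀ j, ‖y j‖ ≤ 1) →
      ∑ i, ∑ j, A i j * inner ℝ (x i) (y j) ≤ K * scalarMax A

/-- Grothendieck's (real) constant: the least `K` for which Grothendieck's inequality holds. -/
def grothendieckConstant : ℝ := sInf {K : ℝ | GrothendieckInequality K}

/-! ### Extractors and their classical error -/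

/-- A family of functions `f_s : [2^n] → [2^m]` with seed `s ∈ [2^d]`. -/
abbrev Extractor (n m d : ℕ) : Type := Fin (2 ^ d) → Fin (2 ^ n) → Fin (2 ^ m)

variable {n m d : ℕ}

/-- The coefficient `δ_{f_s(i) = j} - 1 / 2^m`. -/
def coeff (Ext : Extractor n m d) (i : Fin (2 ^ n)) (s : Fin (2 ^ d)) (j : Fin (2 ^ m)) : ℝ :=
  (if Ext s i = j then 1 else 0) - 1 / 2 ^ m

/-- Feasible points of the classical program: a distribution `z` on `[2^n]` of min-entropy at
least `k`, and a test function `y` on `[2^d] × [2^m]`. -/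
structure ClassicalFeasible (k : ℝ) (z : Fin (2 ^ n) → ℝ) (y : Fin (2 ^ d) × Fin (2 ^ m) → ℝ) :
    Prop where
  z_nonneg : ∀ i, 0 ≤ z i
  z_le : ∀ i, z i ≤ (2 : ℝ) ^ (-k)
  z_sum : ∑ i, z i = 1
  y_nonneg : ∀ sj, 0 ≤ y sj
  y_le : ∀ sj, y sj ≤ 1

def classicalObjective (Ext : Extractor n m d) (z : Fin (2 ^ n) → ℝ)
    (y : Fin (2 ^ d) × Fin (2 ^ m) → ℝ) : ℝ :=
  1 / 2 ^ d * ∑ i, ∑ s, ∑ j, coeff Ext i s j * (z i * y (s, j))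

/-- The values of the classical program at its feasible points. -/
def classicalValues (Ext : Extractor n m d) (k : ℝ) : Set ℝ :=
  {t | ∃ (z : Fin (2 ^ n) → ℝ) (y : Fin (2 ^ d) × Fin (2 ^ m) → ℝ),
    ClassicalFeasible k z y ∧ t = classicalObjective Ext z y}

/-- `Err(Ext, k)`, the classical error of the extractor. -/
def Err (Ext : Extractor n m d) (k : ℝ) : ℝ := sSup (classicalValues Ext k)

/-! ### The simplified first level relaxation -/

/-- Words of length at most one in the symbols `i ∈ [2^n]` and `(s, j) ∈ [2^d] × [2^m]`. -/
abbrev Word (n m d : ℕ) : Type := Option (Fin (2 ^ n) ⊕ (Fin (2 ^ d) × Fin (2 ^ m)))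

/-- The empty word. -/
abbrev emptyW : Word n m d := none

/-- The one-letter word `(i)`. -/
abbrev inW (i : Fin (2 ^ n)) : Word n m d := some (Sum.inl i)

/-- The one-letter word `(s, j)`. -/
abbrev testW (s : Fin (2 ^ d)) (j : Fin (2 ^ m)) : Word n m d := some (Sum.inr (s, j))

/-- Feasible points of the simplified first level relaxation. All the entries are nonnegative,
hence real, so that the positive semidefinite matrices concerned are real symmetric ones. -/
structure SdpFeasible (k : ℝ) (Ω : Matrix (Word n m d) (Word n m d) ℝ) : Prop where
  posSemidef : Ω.PosSemidef
  nonneg : ∀ w w', 0 ≤ Ω w w'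
  empty_empty : Ω emptyW emptyW = 1
  empty_eq_sum : ∀ w, Ω emptyW w = ∑ i, Ω (inW i) w
  in_le : ∀ i w, Ω (inW i) w ≤ (2 : ℝ) ^ (-k) * Ω emptyW w
  test_le : ∀ s j w, Ω (testW s j) w ≤ Ω emptyW w

def sdpObjective (Ext : Extractor n m d) (Ω : Matrix (Word n m d) (Word n m d) ℝ) : ℝ :=
  1 / 2 ^ d * ∑ i, ∑ s, ∑ j, coeff Ext i s j * Ω (inW i) (testW s j)

/-- The values of the simplified first level relaxation at its feasible points. -/
def sdpValues (Ext : Extractor n m d) (k : ℝ) : Set ℝ :=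
  {t | ∃ Ω : Matrix (Word n m d) (Word n m d) ℝ, SdpFeasible k Ω ∧ t = sdpObjective Ext Ω}

/-- The value of the simplified first level relaxation. -/
def ErrSdp (Ext : Extractor n m d) (k : ℝ) : ℝ := sSup (sdpValues Ext k)

/-! ### The suprema above are over nonempty bounded sets -/

theorem scalarMax_nonempty {p q : ℕ} (A : Matrix (Fin p) (Fin q) ℝ) :
    {t : ℝ | ∃ (a : Fin p → ℝ) (b : Fin q → ℝ),
      (∀ i, |a i| ≤ 1) ∧ (∀ j, |b j| ≤ 1) ∧ t = ∑ i, ∑ j, A i j * (a i * b j)}.Nonempty :=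
  ⟨_, 0, 0, by simp, by simp, rfl⟩

theorem scalarMax_bddAbove {p q : ℕ} (A : Matrix (Fin p) (Fin q) ℝ) :
    BddAbove {t : ℝ | ∃ (a : Fin p → ℝ) (b : Fin q → ℝ),
      (∀ i, |a i| ≤ 1) ∧ (∀ j, |b j| ≤ 1) ∧ t = ∑ i, ∑ j, A i j * (a i * b j)} := by
  refine ⟨∑ i, ∑ j, |A i j|, ?_⟩
  rintro t ⟨a, b, ha, hb, rfl⟩
  refine Finset.sum_le_sum fun i _ => Finset.sum_le_sum fun j _ => ?_
  refine (le_abs_self _).trans ?_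
  rw [abs_mul, abs_mul]
  exact mul_le_of_le_one_right (abs_nonneg _) (mul_le_one₀ (ha i) (abs_nonneg _) (hb j))

theorem bddBelow_grothendieck : BddBelow {K : ℝ | GrothendieckInequality K} := by
  refine ⟨0, fun K hK => ?_⟩
  have h := hK 1 1 (fun _ _ => 1) 1 (fun _ => EuclideanSpace.single 0 1)
    (fun _ => EuclideanSpace.single 0 1) (by simp) (by simp)
  have h0 : 0 ≤ scalarMax (fun _ _ => 1 : Matrix (Fin 1) (Fin 1) ℝ) :=
    le_csSup (scalarMax_bddAbove _) ⟨0, 0, by simp, by simp, by simp⟩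
  simp at h
  by_contra hneg
  push Not at hneg
  nlinarith

theorem uniform_le {k : ℝ} (hk : k ≤ n) : (1 : ℝ) / 2 ^ n ≤ (2 : ℝ) ^ (-k) := by
  rw [one_div, ← Real.rpow_natCast, ← Real.rpow_neg (by norm_num)]
  exact Real.rpow_le_rpow_of_exponent_le (by norm_num) (by linarith)

theorem classicalValues_nonempty (Ext : Extractor n m d) {k : ℝ} (hk : k ≤ n) :
    (classicalValues Ext k).Nonempty :=
  ⟨_, fun _ => 1 / 2 ^ n, 0,
    ⟨fun _ => by positivity, fun _ => uniform_le hk, by simp, by simp, by simp⟩, rfl⟩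

theorem classicalValues_bddAbove (Ext : Extractor n m d) (k : ℝ) :
    BddAbove (classicalValues Ext k) := by
  refine ⟨1 / 2 ^ d * ∑ i, ∑ s, ∑ j, |coeff Ext i s j|, ?_⟩
  rintro t ⟨z, y, h, rfl⟩
  refine mul_le_mul_of_nonneg_left (Finset.sum_le_sum fun i _ => Finset.sum_le_sum fun s _ =>
    Finset.sum_le_sum fun j _ => ?_) (by positivity)
  have hz : z i ≤ 1 := h.z_sum ▸
    Finset.single_le_sum (fun i _ => h.z_nonneg i) (Finset.mem_univ i)
  refine (mul_le_mul_of_nonneg_right (le_abs_self _)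
    (mul_nonneg (h.z_nonneg i) (h.y_nonneg _))).trans ?_
  exact mul_le_of_le_one_right (abs_nonneg _) (mul_le_one₀ hz (h.y_nonneg _) (h.y_le _))

theorem sdpValues_nonempty (Ext : Extractor n m d) {k : ℝ} (hk : k ≤ n) :
    (sdpValues Ext k).Nonempty := by
  let v : Word n m d → ℝ := fun w => w.elim 1 (Sum.elim (fun _ => 1 / 2 ^ n) (fun _ => 0))
  have hv : ∀ w, 0 ≤ v w := by
    rintro (_ | i | sj) <;> simp [v]
  refine ⟨_, Matrix.vecMulVec v v, ⟨?_, ?_, ?_, ?_, ?_, ?_⟩, rfl⟩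
  · simpa using Matrix.posSemidef_vecMulVec_self_star v
  · exact fun w w' => mul_nonneg (hv w) (hv w')
  · simp [Matrix.vecMulVec_apply, v]
  · intro w
    simp [Matrix.vecMulVec_apply, v]
  · intro i w
    have := mul_le_mul_of_nonneg_right (uniform_le hk) (hv w)
    simpa [Matrix.vecMulVec_apply, v] using this
  · intro s j w
    have := hv w
    simpa [Matrix.vecMulVec_apply, v] using this

theorem sdpValues_bddAbove (Ext : Extractor n m d) (k : ℝ) :
    BddAbove (sdpValues Ext k) := by
  refine ⟨1 / 2 ^ d * ∑ i, ∑ s, ∑ j, |coeff Ext i s j|, ?_⟩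
  rintro t ⟨Ω, h, rfl⟩
  refine mul_le_mul_of_nonneg_left (Finset.sum_le_sum fun i _ => Finset.sum_le_sum fun s _ =>
    Finset.sum_le_sum fun j _ => ?_) (by positivity)
  have h1 : Ω (inW i) (testW s j) ≤ Ω emptyW (testW s j) := by
    rw [h.empty_eq_sum (testW s j)]
    exact Finset.single_le_sum (f := fun i => Ω (inW i) (testW s j))
      (fun i _ => h.nonneg _ _) (Finset.mem_univ i)
  have h2 : Ω emptyW (testW s j) = Ω (testW s j) emptyW := by
    simpa using h.posSemidef.isHermitian.apply (testW s j) emptyW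
  have h3 := h.test_le s j emptyW
  rw [h.empty_empty] at h3
  refine (mul_le_mul_of_nonneg_right (le_abs_self _) (h.nonneg _ _)).trans ?_
  exact mul_le_of_le_one_right (abs_nonneg _) (by linarith)

end QProofExtractor

end

namespace QProofExtractor

/-! ### Rademacher sums -/

/-! Both bounds view a feasible `Ω` as a Gram matrix: the vectors of the words `(s, j)` have norm at
most 1, those of the words `(i)` norm at most `2^(-k)`. For the first bound, Cauchy–Schwarz reduces
the objective to the sum over `(s, j)` of `‖∑ᵢ coeff i s j • aᵢ‖²`. Since coefficients sum to zero
over `j`, this is a sum over `i` of classical objectives whose test is the graph of `s ↦ f_s(i)` and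
whose source is the column `Ω (·) (i)`, of mass `Ω ∅ (i)`. These masses add up to 1
(`sum_coeff_mul_coeff_le`). For the second, Grothendieck's inequality replaces vectors by scalars in
`[-1, 1]`, and `bilinForm_le_of_abs_le_one` writes the scalar form as a combination of three
classical objectives at min-entropy `k - 1`. As `grothendieckConstant` is an infimum, it satisfies
the inequality only once some finite constant is known to work; 8 is obtained by truncating
Rademacher sums. -/

/-- The sign attached to a Boolean. -/
def boolSign (b : Bool) : ℝ := if b then 1 else -1

/-- The Rademacher sum with coefficients `u`, as a function on the discrete cube. -/
def rademacherSum {r : ℕ} (u : Fin r → ℝ) (ε : Fin r → Bool) : ℝ := ∑ k, u k * boolSign (ε k)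

theorem sum_cube_succ {r : ℕ} (F : (Fin (r + 1) → Bool) → ℝ) :
    ∑ ε, F ε = ∑ ε : Fin r → Bool, (F (Fin.cons true ε) + F (Fin.cons false ε)) := by
  rw [← (Fin.consEquiv fun _ => Bool).sum_comp, Fintype.sum_prod_type, Fintype.sum_bool,
    Finset.sum_add_distrib]
  rfl

theorem rademacherSum_cons {r : ℕ} (u : Fin (r + 1) → ℝ) (b : Bool) (ε : Fin r → Bool) :
    rademacherSum u (Fin.cons b ε) = u 0 * boolSign b + rademacherSum (Fin.tail u) ε := by
  simp [rademacherSum, Fin.sum_univ_succ, Fin.tail]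

theorem sum_rademacherSum_mul {r : ℕ} (u v : Fin r → ℝ) :
    ∑ ε, rademacherSum u ε * rademacherSum v ε = 2 ^ r * ∑ k, u k * v k := by
  induction r with
  | zero => simp [rademacherSum]
  | succ r ih =>
    have h := ih (Fin.tail u) (Fin.tail v)
    have e : ∀ ε : Fin r → Bool,
        rademacherSum u (Fin.cons true ε) * rademacherSum v (Fin.cons true ε)
          + rademacherSum u (Fin.cons false ε) * rademacherSum v (Fin.cons false ε)
        = 2 * (rademacherSum (Fin.tail u) ε * rademacherSum (Fin.tail v) ε)
          + 2 * (u 0 * v 0) := by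
      intro ε
      simp only [rademacherSum_cons, boolSign, if_true, Bool.false_eq_true, if_false]
      ring
    rw [sum_cube_succ, Finset.sum_congr rfl fun ε _ => e ε, Finset.sum_add_distrib,
      ← Finset.mul_sum, h, Fin.sum_univ_succ]
    simp [Fin.tail]
    ring

/-- Khintchine's inequality for the fourth moment. Averaging over the first sign cancels the odd
powers, and `1 + 6ab + 3b² ≤ 3(a + b)²`-type bookkeeping is left, with `u 0 ^ 4` to spare. -/
theorem sum_rademacherSum_pow_four_le {r : ℕ} (u : Fin r → ℝ) :
    ∑ ε, rademacherSum u ε ^ 4 ≤ 2 ^ r * (3 * (∑ k, u k ^ 2) ^ 2) := by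
  induction r with
  | zero => simp [rademacherSum]
  | succ r ih =>
    have h := ih (Fin.tail u)
    have h2 := sum_rademacherSum_mul (Fin.tail u) (Fin.tail u)
    have e : ∀ ε : Fin r → Bool,
        rademacherSum u (Fin.cons true ε) ^ 4 + rademacherSum u (Fin.cons false ε) ^ 4
        = 2 * rademacherSum (Fin.tail u) ε ^ 4
          + 12 * u 0 ^ 2 * (rademacherSum (Fin.tail u) ε * rademacherSum (Fin.tail u) ε)
          + 2 * u 0 ^ 4 := by
      intro ε
      simp only [rademacherSum_cons, boolSign, if_true, Bool.false_eq_true, if_false]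
      ring
    have h3 : ∑ k, Fin.tail u k * Fin.tail u k = ∑ k, Fin.tail u k ^ 2 :=
      Finset.sum_congr rfl fun k _ => (sq _).symm
    rw [sum_cube_succ, Finset.sum_congr rfl fun ε _ => e ε, Finset.sum_add_distrib,
      Finset.sum_add_distrib, ← Finset.mul_sum, ← Finset.mul_sum, h2, h3, Fin.sum_univ_succ]
    have h4 : ∑ k : Fin r, u k.succ ^ 2 = ∑ k, Fin.tail u k ^ 2 := rfl
    rw [h4]
    set q := ∑ k, Fin.tail u k ^ 2
    have h5 : ∑ _ε : Fin r → Bool, 2 * u 0 ^ 4 = 2 ^ r * (2 * u 0 ^ 4) := by simp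
    rw [h5, pow_succ (2 : ℝ) r]
    have h6 : 0 ≤ (2 : ℝ) ^ r * u 0 ^ 4 := by positivity
    linarith

/-! ### Grothendieck's inequality -/

/-- Truncation of a real number to `[-2, 2]`. -/
def clip (t : ℝ) : ℝ := max (-2) (min 2 t)

theorem abs_clip_le (t : ℝ) : |clip t| ≤ 2 :=
  abs_le.2 ⟨le_max_left _ _, max_le (by norm_num) (min_le_left _ _)⟩

theorem clip_sq_le (t : ℝ) : clip t ^ 2 ≤ t ^ 2 := by
  unfold clip
  rcases max_cases (-2) (min 2 t) with h | h <;> rcases min_cases 2 t with h' | h' <;>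
    rw [h.1] <;> nlinarith

theorem sub_clip_sq_le (t : ℝ) : (t - clip t) ^ 2 ≤ t ^ 4 / 64 := by
  have key : ∀ a : ℝ, 2 ≤ a → (a - 2) ^ 2 ≤ a ^ 4 / 64 := fun a ha => by
    -- Tangent line of `a² / 8` at `a = 4`.
    have h1 : a - 2 ≤ a ^ 2 / 8 := by nlinarith [sq_nonneg (a - 4)]
    calc (a - 2) ^ 2 ≤ (a ^ 2 / 8) ^ 2 := pow_le_pow_left₀ (by linarith) h1 2
      _ = a ^ 4 / 64 := by ring
  unfold clip
  rcases le_total 2 t with h | h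
  · rw [min_eq_left h, max_eq_right (by norm_num)]
    exact key t h
  · rw [min_eq_right h]
    rcases le_total (-2) t with h' | h'
    · rw [max_eq_right h', sub_self, zero_pow two_ne_zero]
      exact div_nonneg (Even.pow_nonneg (by decide) t) (by norm_num)
    · rw [max_eq_left h']
      calc (t - -2) ^ 2 = (-t - 2) ^ 2 := by ring
        _ ≤ (-t) ^ 4 / 64 := key (-t) (by linarith)
        _ = t ^ 4 / 64 := by ring

/-- `C` bounds the vector version of the bilinear form of `A`. -/
def VectorBound {p q : ℕ} (A : Matrix (Fin p) (Fin q) ℝ) (C : ℝ) : Prop :=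
  ∀ (r : ℕ) (x : Fin p → EuclideanSpace ℝ (Fin r)) (y : Fin q → EuclideanSpace ℝ (Fin r)),
    (∀ i, ‖x i‖ ≤ 1) → (∀ j, ‖y j‖ ≤ 1) → ∑ i, ∑ j, A i j * inner ℝ (x i) (y j) ≤ C

/-- Functions on a finite set are vectors of a Euclidean space; dividing by `F` and `G` brings them
into the unit ball. -/
theorem VectorBound.sum_le {p q : ℕ} {A : Matrix (Fin p) (Fin q) ℝ} {C : ℝ}
    (h : VectorBound A C) {ι : Type*} [Fintype ι] (f : Fin p → ι → ℝ) (g : Fin q → ι → ℝ)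
    {F G : ℝ} (hF : 0 < F) (hG : 0 < G) (hf : ∀ i, ∑ e, f i e ^ 2 ≤ F ^ 2)
    (hg : ∀ j, ∑ e, g j e ^ 2 ≤ G ^ 2) :
    ∑ i, ∑ j, A i j * ∑ e, f i e * g j e ≤ C * (F * G) := by
  let E := Fintype.equivFin ι
  have norm_le : ∀ (c : ι → ℝ) (D : ℝ), 0 < D → ∑ e, c e ^ 2 ≤ D ^ 2 →
      ‖(WithLp.toLp 2 fun k => c (E.symm k) / D : EuclideanSpace ℝ (Fin (Fintype.card ι)))‖ ≤ 1 := by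
    intro c D hD hc
    rw [← sq_le_one_iff₀ (norm_nonneg _), EuclideanSpace.real_norm_sq_eq]
    have e : ∑ k, (c (E.symm k) / D) ^ 2 = (∑ e, c e ^ 2) / D ^ 2 := by
      simp only [div_pow]
      rw [E.symm.sum_comp fun e => c e ^ 2 / D ^ 2, Finset.sum_div]
    exact e.trans_le ((div_le_one (by positivity)).2 hc)
  have h1 := h (Fintype.card ι) (fun i => WithLp.toLp 2 fun k => f i (E.symm k) / F)
    (fun j => WithLp.toLp 2 fun k => g j (E.symm k) / G)
    (fun i => norm_le _ _ hF (hf i)) (fun j => norm_le _ _ hG (hg j))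
  have h2 : ∀ i j, inner ℝ
      (WithLp.toLp 2 fun k => f i (E.symm k) / F : EuclideanSpace ℝ (Fin (Fintype.card ι)))
      (WithLp.toLp 2 fun k => g j (E.symm k) / G) = (∑ e, f i e * g j e) / (F * G) := by
    intro i j
    rw [PiLp.inner_apply, ← E.symm.sum_comp, Finset.sum_div]
    refine Finset.sum_congr rfl fun k _ => ?_
    simp
    field_simp
  simp only [h2, ← mul_div_assoc, ← Finset.sum_div] at h1
  rwa [div_le_iff₀ (by positivity)] at h1

theorem scalarMax_nonneg {p q : ℕ} (A : Matrix (Fin p) (Fin q) ℝ) : 0 ≤ scalarMax A :=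
  le_csSup (scalarMax_bddAbove A) ⟨0, 0, by simp, by simp, by simp⟩

theorem sum_le_mul_scalarMax {p q : ℕ} (A : Matrix (Fin p) (Fin q) ℝ) {D : ℝ} (hD : 0 < D)
    (a : Fin p → ℝ) (b : Fin q → ℝ) (ha : ∀ i, |a i| ≤ D) (hb : ∀ j, |b j| ≤ D) :
    ∑ i, ∑ j, A i j * (a i * b j) ≤ D ^ 2 * scalarMax A := by
  have h : ∑ i, ∑ j, A i j * (a i / D * (b j / D)) ≤ scalarMax A := by
    refine le_csSup (scalarMax_bddAbove A) ⟨fun i => a i / D, fun j => b j / D, ?_, ?_, rfl⟩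
    · intro i
      rw [abs_div, abs_of_pos hD]
      exact (div_le_one hD).2 (ha i)
    · intro j
      rw [abs_div, abs_of_pos hD]
      exact (div_le_one hD).2 (hb j)
  have e : ∑ i, ∑ j, A i j * (a i * b j) = D ^ 2 * ∑ i, ∑ j, A i j * (a i / D * (b j / D)) := by
    simp only [Finset.mul_sum]
    refine Finset.sum_congr rfl fun i _ => Finset.sum_congr rfl fun j _ => ?_
    field_simp
  rw [e]
  exact mul_le_mul_of_nonneg_left h (by positivity)

/-- Rademacher sums embed the vectors isometrically, up to scale, into functions on the cube. The
truncated parts are bounded scalars at each point, giving `4 * scalarMax A`; each of the two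
remainders is small in L², so the hypothesis bounds it by `C / 4`. -/
theorem VectorBound.improve {p q : ℕ} {A : Matrix (Fin p) (Fin q) ℝ} {C : ℝ}
    (h : VectorBound A C) : VectorBound A (4 * scalarMax A + C / 2) := by
  intro r x y hx hy
  have sq_le : ∀ v : EuclideanSpace ℝ (Fin r), ‖v‖ ≤ 1 → ∑ k, v k ^ 2 ≤ 1 := fun v hv => by
    rw [← EuclideanSpace.real_norm_sq_eq]
    exact pow_le_one₀ (norm_nonneg _) hv
  let R : EuclideanSpace ℝ (Fin r) → (Fin r → Bool) → ℝ := fun v => rademacherSum v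
  set N : ℝ := 2 ^ r with hN
  have hN0 : 0 < N := by positivity
  set F : ℝ := √N with hF
  have hF0 : 0 < F := Real.sqrt_pos.2 hN0
  have hFF : F ^ 2 = N := Real.sq_sqrt hN0.le
  have hR : ∀ v : EuclideanSpace ℝ (Fin r), ‖v‖ ≤ 1 → ∑ e, R v e ^ 2 ≤ F ^ 2 := fun v hv => by
    have := sum_rademacherSum_mul (r := r) v v
    simp only [← sq] at this
    rw [this, hFF]
    exact mul_le_of_le_one_right hN0.le (sq_le v hv)
  have hRc : ∀ v : EuclideanSpace ℝ (Fin r), ‖v‖ ≤ 1 → ∑ e, clip (R v e) ^ 2 ≤ F ^ 2 :=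
    fun v hv => (Finset.sum_le_sum fun e _ => clip_sq_le _).trans (hR v hv)
  -- The fourth moment gives `3 / 64`, at most `(1 / 4) ^ 2`.
  have hRd : ∀ v : EuclideanSpace ℝ (Fin r), ‖v‖ ≤ 1 →
      ∑ e, (R v e - clip (R v e)) ^ 2 ≤ (F / 4) ^ 2 := fun v hv => by
    have h1 := sum_rademacherSum_pow_four_le (r := r) v
    have h2 : (∑ k, v k ^ 2) ^ 2 ≤ 1 :=
      pow_le_one₀ (Finset.sum_nonneg fun _ _ => sq_nonneg _) (sq_le v hv)
    calc ∑ e, (R v e - clip (R v e)) ^ 2 ≤ ∑ e, R v e ^ 4 / 64 :=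
          Finset.sum_le_sum fun e _ => sub_clip_sq_le _
      _ = (∑ e, R v e ^ 4) / 64 := by rw [Finset.sum_div]
      _ ≤ N * (3 * 1) / 64 := by
          have : N * (3 * (∑ k, v k ^ 2) ^ 2) ≤ N * (3 * 1) := by gcongr
          exact div_le_div_of_nonneg_right (h1.trans this) (by norm_num)
      _ ≤ (F / 4) ^ 2 := by rw [div_pow, hFF]; linarith
  have t1 : ∑ i, ∑ j, A i j * ∑ e, clip (R (x i) e) * clip (R (y j) e)
      ≤ N * (4 * scalarMax A) := by
    have e1 : ∑ i, ∑ j, A i j * ∑ e, clip (R (x i) e) * clip (R (y j) e)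
        = ∑ e, ∑ i, ∑ j, A i j * (clip (R (x i) e) * clip (R (y j) e)) := by
      simp only [Finset.mul_sum]
      rw [Finset.sum_comm (s := (Finset.univ : Finset (Fin r → Bool)))]
      exact Finset.sum_congr rfl fun i _ => Finset.sum_comm
    rw [e1]
    calc _ ≤ ∑ _e : Fin r → Bool, 2 ^ 2 * scalarMax A := Finset.sum_le_sum fun e _ =>
          sum_le_mul_scalarMax A two_pos _ _ (fun _ => abs_clip_le _) (fun _ => abs_clip_le _)
      _ = N * (4 * scalarMax A) := by simp [hN]; norm_num
  have t2 := h.sum_le (fun i e => R (x i) e - clip (R (x i) e)) (fun j e => clip (R (y j) e))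
    (F := F / 4) (by positivity) hF0 (fun i => hRd _ (hx i)) (fun j => hRc _ (hy j))
  have t3 := h.sum_le (fun i e => R (x i) e) (fun j e => R (y j) e - clip (R (y j) e))
    (G := F / 4) hF0 (by positivity) (fun i => hR _ (hx i)) (fun j => hRd _ (hy j))
  have e2 : N * ∑ i, ∑ j, A i j * inner ℝ (x i) (y j)
      = ∑ i, ∑ j, A i j * ∑ e, clip (R (x i) e) * clip (R (y j) e)
        + ∑ i, ∑ j, A i j * ∑ e, (R (x i) e - clip (R (x i) e)) * clip (R (y j) e)
        + ∑ i, ∑ j, A i j * ∑ e, R (x i) e * (R (y j) e - clip (R (y j) e)) := by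
    simp only [Finset.mul_sum (s := (Finset.univ : Finset (Fin p))),
      Finset.mul_sum (s := (Finset.univ : Finset (Fin q))), ← Finset.sum_add_distrib]
    refine Finset.sum_congr rfl fun i _ => Finset.sum_congr rfl fun j _ => ?_
    have := sum_rademacherSum_mul (r := r) (x i) (y j)
    rw [← mul_add, ← mul_add, ← Finset.sum_add_distrib, ← Finset.sum_add_distrib, mul_left_comm]
    congr 1
    calc N * inner ℝ (x i) (y j) = ∑ e, R (x i) e * R (y j) e := by
          rw [this, PiLp.inner_apply]
          simp [hN, mul_comm]
      _ = _ := Finset.sum_congr rfl fun e _ => by ring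
  have hFF' : F * F = N := by rw [← sq, hFF]
  have e3 : C * (F / 4 * F) = N * (C / 4) := by rw [← hFF']; ring
  have e4 : C * (F * (F / 4)) = N * (C / 4) := by rw [← hFF']; ring
  rw [e3] at t2
  rw [e4] at t3
  refine le_of_mul_le_mul_left ?_ hN0
  rw [e2]
  linarith

theorem vectorBound_sum_abs {p q : ℕ} (A : Matrix (Fin p) (Fin q) ℝ) :
    VectorBound A (∑ i, ∑ j, |A i j|) := by
  intro r x y hx hy
  refine Finset.sum_le_sum fun i _ => Finset.sum_le_sum fun j _ => (le_abs_self _).trans ?_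
  rw [abs_mul]
  exact mul_le_of_le_one_right (abs_nonneg _)
    ((abs_real_inner_le_norm _ _).trans (mul_le_one₀ (hx i) (norm_nonneg _) (hy j)))

/-- Grothendieck's inequality, with constant `8`. -/
theorem grothendieckInequality_eight : GrothendieckInequality 8 := by
  intro p q A
  let S : Set ℝ := {t | ∃ (r : ℕ) (x : Fin p → EuclideanSpace ℝ (Fin r))
    (y : Fin q → EuclideanSpace ℝ (Fin r)), (∀ i, ‖x i‖ ≤ 1) ∧ (∀ j, ‖y j‖ ≤ 1) ∧
      t = ∑ i, ∑ j, A i j * inner ℝ (x i) (y j)}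
  have hS : BddAbove S := by
    refine ⟨∑ i, ∑ j, |A i j|, ?_⟩
    rintro t ⟨r, x, y, hx, hy, rfl⟩
    exact vectorBound_sum_abs A r x y hx hy
  have hS0 : S.Nonempty := ⟨_, 0, 0, 0, by simp, by simp, rfl⟩
  have hb : VectorBound A (sSup S) := fun r x y hx hy => le_csSup hS ⟨r, x, y, hx, hy, rfl⟩
  -- The supremum is finite, so half of it can be absorbed on the left.
  have hle : sSup S ≤ 4 * scalarMax A + sSup S / 2 := by
    refine csSup_le hS0 ?_
    rintro t ⟨r, x, y, hx, hy, rfl⟩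
    exact hb.improve r x y hx hy
  intro r x y hx hy
  exact (hb r x y hx hy).trans (by linarith)

/-- The infimum defining Grothendieck's constant is attained. -/
theorem grothendieckInequality_grothendieckConstant :
    GrothendieckInequality grothendieckConstant := by
  intro p q A r x y hx hy
  rcases (scalarMax_nonneg A).eq_or_lt with h0 | h0
  -- With `scalarMax A = 0` every constant gives the same bound.
  · have := grothendieckInequality_eight p q A r x y hx hy
    rwa [← h0, mul_zero] at this ⊢
  · rw [← div_le_iff₀ h0]
    refine le_csInf ⟨8, grothendieckInequality_eight⟩ fun K hK => ?_
    rw [div_le_iff₀ h0]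
    exact hK p q A r x y hx hy

theorem grothendieckConstant_nonneg : 0 ≤ grothendieckConstant := by
  refine Real.sInf_nonneg fun K hK => ?_
  have h := hK 1 1 (fun _ _ => 1) 1 (fun _ => EuclideanSpace.single 0 1)
    (fun _ => EuclideanSpace.single 0 1) (by simp) (by simp)
  have h0 := scalarMax_nonneg (fun _ _ => 1 : Matrix (Fin 1) (Fin 1) ℝ)
  simp at h
  by_contra hneg
  push Not at hneg
  nlinarith

/-- Grothendieck's inequality for arbitrary finite index types. -/
theorem sum_inner_le_of_forall_sum_le {α β γ : Type*} [Fintype α] [Fintype β] [Fintype γ]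
    (A : α → β → ℝ) (x : α → EuclideanSpace ℝ γ) (y : β → EuclideanSpace ℝ γ)
    (hx : ∀ i, ‖x i‖ ≤ 1) (hy : ∀ j, ‖y j‖ ≤ 1) {B : ℝ}
    (hB : ∀ (a : α → ℝ) (b : β → ℝ), (∀ i, |a i| ≤ 1) → (∀ j, |b j| ≤ 1) →
      ∑ i, ∑ j, A i j * (a i * b j) ≤ B) :
    ∑ i, ∑ j, A i j * inner ℝ (x i) (y j) ≤ grothendieckConstant * B := by
  let ea := Fintype.equivFin α
  let eb := Fintype.equivFin β
  let L := LinearIsometryEquiv.piLpCongrLeft 2 ℝ ℝ (Fintype.equivFin γ)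
  have h := grothendieckInequality_grothendieckConstant _ _
    (fun i j => A (ea.symm i) (eb.symm j)) _ (fun i => L (x (ea.symm i)))
    (fun j => L (y (eb.symm j))) (fun i => by rw [L.norm_map]; exact hx _)
    (fun j => by rw [L.norm_map]; exact hy _)
  simp only [L.inner_map_map] at h
  rw [ea.symm.sum_comp fun i => ∑ j, A i (eb.symm j) * inner ℝ (x i) (y (eb.symm j))] at h
  simp only [fun i => eb.symm.sum_comp fun j => A i j * inner ℝ (x i) (y j)] at h
  refine h.trans (mul_le_mul_of_nonneg_left ?_ grothendieckConstant_nonneg)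
  refine csSup_le (scalarMax_nonempty _) ?_
  rintro t ⟨a, b, ha, hb, rfl⟩
  have := hB (fun i => a (ea i)) (fun j => b (eb j)) (fun i => ha _) (fun j => hb _)
  rw [← ea.symm.sum_comp] at this
  simp only [← eb.symm.sum_comp, Equiv.apply_symm_apply] at this
  exact this

/-! ### The classical bilinear form -/

variable {n m d : ℕ}

/-- The bilinear form of the classical program, without normalization. -/
noncomputable def bilinForm (Ext : Extractor n m d) (z : Fin (2 ^ n) → ℝ)
    (y : Fin (2 ^ d) × Fin (2 ^ m) → ℝ) : ℝ :=
  ∑ i, ∑ s, ∑ j, coeff Ext i s j * (z i * y (s, j))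

theorem sum_coeff (Ext : Extractor n m d) (i : Fin (2 ^ n)) (s : Fin (2 ^ d)) :
    ∑ j, coeff Ext i s j = 0 := by
  simp [coeff]

theorem bilinForm_le (Ext : Extractor n m d) {k : ℝ} {z : Fin (2 ^ n) → ℝ}
    {y : Fin (2 ^ d) × Fin (2 ^ m) → ℝ} (h : ClassicalFeasible k z y) :
    bilinForm Ext z y ≤ 2 ^ d * Err Ext k := by
  have h1 : classicalObjective Ext z y ≤ Err Ext k :=
    le_csSup (classicalValues_bddAbove Ext k) ⟨z, y, h, rfl⟩
  have h2 : bilinForm Ext z y = 2 ^ d * classicalObjective Ext z y := by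
    simp only [bilinForm, classicalObjective]
    field_simp
  rw [h2]
  exact mul_le_mul_of_nonneg_left h1 (by positivity)

/-- The homogeneous form of `bilinForm_le`: the weight `z` has total mass `c`. -/
theorem bilinForm_le_mul (Ext : Extractor n m d) {k c : ℝ} {z : Fin (2 ^ n) → ℝ}
    {y : Fin (2 ^ d) × Fin (2 ^ m) → ℝ} (hz : ∀ i, 0 ≤ z i) (hzk : ∀ i, z i ≤ (2 : ℝ) ^ (-k) * c)
    (hzc : ∑ i, z i = c) (hy : ∀ sj, 0 ≤ y sj) (hy1 : ∀ sj, y sj ≤ 1) :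
    bilinForm Ext z y ≤ c * (2 ^ d * Err Ext k) := by
  rcases (hzc ▸ Finset.sum_nonneg fun i _ => hz i : 0 ≤ c).eq_or_lt with hc | hc
  · have h0 : ∀ i, z i = 0 := fun i =>
      le_antisymm (by simpa [← hc] using hzk i) (hz i)
    simp [bilinForm, h0, ← hc]
  · have h := bilinForm_le Ext (k := k) (z := fun i => z i / c) (y := y)
      ⟨fun i => div_nonneg (hz i) hc.le, fun i => (div_le_iff₀ hc).2 (hzk i),
        by rw [← Finset.sum_div, hzc, div_self hc.ne'], hy, hy1⟩
    have e : bilinForm Ext z y = c * bilinForm Ext (fun i => z i / c) y := by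
      simp only [bilinForm, Finset.mul_sum]
      refine Finset.sum_congr rfl fun i _ => Finset.sum_congr rfl fun s _ =>
        Finset.sum_congr rfl fun j _ => ?_
      field_simp
    rw [e]
    exact mul_le_mul_of_nonneg_left h hc.le

/-- The bilinear form on the cubes `[-1, 1]`, bounded by the error at min-entropy `k - 1`. -/
theorem bilinForm_le_of_abs_le_one (Ext : Extractor n m d) {k : ℝ} (hk : k ≤ n)
    (a : Fin (2 ^ n) → ℝ) (b : Fin (2 ^ d) × Fin (2 ^ m) → ℝ) (ha : ∀ i, |a i| ≤ 1)
    (hb : ∀ sj, |b sj| ≤ 1) :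
    bilinForm Ext a b ≤ 6 * 2 ^ n * (2 ^ d * Err Ext (k - 1)) := by
  set N : ℝ := 2 ^ n with hN
  have hN0 : 0 < N := by positivity
  have hcard : ∀ c : ℝ, ∑ _i : Fin (2 ^ n), c = N * c := fun c => by simp [hN]
  have h2k : 2 / N ≤ (2 : ℝ) ^ (-(k - 1)) := by
    have h1 := uniform_le hk
    have h2 : (2 : ℝ) ^ (-(k - 1)) = 2 * 2 ^ (-k) := by
      rw [neg_sub, sub_eq_add_neg, Real.rpow_add two_pos, Real.rpow_one]
    rw [h2]
    calc 2 / N = 2 * (1 / 2 ^ n) := by rw [hN]; ring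
      _ ≤ _ := by linarith
  -- Adding the constant `1 - mean P` makes the mass exactly 1 after division by `N`. The entries
  -- are at most `2 / N`, which is what costs one bit of min-entropy.
  have padded : ∀ (P : Fin (2 ^ n) → ℝ) (y : Fin (2 ^ d) × Fin (2 ^ m) → ℝ),
      (∀ i, 0 ≤ P i) → (∀ i, P i ≤ 1) → (∀ sj, |y sj| ≤ 1) →
      bilinForm Ext (fun i => (P i + (1 - (∑ i, P i) / N)) / N) (fun sj => (1 + y sj) / 2)
        ≤ 2 ^ d * Err Ext (k - 1) := by
    intro P y hP hP1 hy
    have hs0 : 0 ≤ (∑ i, P i) / N := div_nonneg (Finset.sum_nonneg fun i _ => hP i) hN0.le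
    have hs1 : (∑ i, P i) / N ≤ 1 := by
      rw [div_le_one hN0]
      calc ∑ i, P i ≤ ∑ _i : Fin (2 ^ n), (1 : ℝ) := Finset.sum_le_sum fun i _ => hP1 i
        _ = N := by rw [hcard, mul_one]
    refine bilinForm_le Ext ⟨fun i => div_nonneg (by linarith [hP i]) hN0.le,
      fun i => le_trans ?_ h2k, ?_, fun sj => ?_, fun sj => ?_⟩
    · exact div_le_div_of_nonneg_right (by linarith [hP1 i]) hN0.le
    · rw [← Finset.sum_div, Finset.sum_add_distrib, hcard]
      field_simp
      ring
    · linarith [(abs_le.1 (hy sj)).1]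
    · linarith [(abs_le.1 (hy sj)).2]
  set P : Fin (2 ^ n) → ℝ := fun i => max (a i) 0
  set Q : Fin (2 ^ n) → ℝ := fun i => max (-a i) 0
  have hPQ : ∀ i, P i - Q i = a i := fun i => max_zero_sub_max_neg_zero_eq_self (a i)
  set τ : ℝ := (∑ i, a i) / N with hτ
  have hτ1 : |τ| ≤ 1 := by
    rw [hτ, abs_div, abs_of_pos hN0, div_le_one hN0]
    calc |∑ i, a i| ≤ ∑ i, |a i| := Finset.abs_sum_le_sum_abs _ _
      _ ≤ ∑ _i : Fin (2 ^ n), (1 : ℝ) := Finset.sum_le_sum fun i _ => ha i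
      _ = N := by rw [hcard, mul_one]
  have hτPQ : τ = (∑ i, P i) / N - (∑ i, Q i) / N := by
    rw [hτ, ← sub_div, ← Finset.sum_sub_distrib]
    simp only [hPQ]
  have h1 := padded P b (fun i => le_max_right _ _)
    (fun i => max_le (abs_le.1 (ha i)).2 zero_le_one) hb
  have h2 := padded Q (fun sj => -b sj) (fun i => le_max_right _ _)
    (fun i => max_le (by linarith [(abs_le.1 (ha i)).1]) zero_le_one)
    (fun sj => by rw [abs_neg]; exact hb sj)
  -- The paddings of `P` and `Q` contribute an unwanted `-τ * b`; a uniform source with test `τ * b`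
  -- cancels it.
  have h3 := padded 0 (fun sj => τ * b sj) (fun _ => le_rfl) (fun _ => zero_le_one)
    (fun sj => by rw [abs_mul]; exact mul_le_one₀ hτ1 (abs_nonneg _) (hb sj))
  set p := (∑ i, P i) / N
  set q := (∑ i, Q i) / N
  have e : bilinForm Ext a b
      = 2 * N * (bilinForm Ext (fun i => (P i + (1 - p)) / N) (fun sj => (1 + b sj) / 2)
        + bilinForm Ext (fun i => (Q i + (1 - q)) / N) (fun sj => (1 + -b sj) / 2)
        + bilinForm Ext (fun i => ((0 : Fin (2 ^ n) → ℝ) i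
            + (1 - (∑ i, (0 : Fin (2 ^ n) → ℝ) i) / N)) / N) (fun sj => (1 + τ * b sj) / 2)) := by
    simp only [bilinForm, ← Finset.sum_add_distrib, Finset.mul_sum (a := 2 * N)]
    refine Finset.sum_congr rfl fun i _ => Finset.sum_congr rfl fun s _ => ?_
    -- These are the terms free of `b`, coming from the 1 in each test `(1 + y) / 2`.
    have hz : ∑ j, coeff Ext i s j * (P i + Q i + (1 - p) + (1 - q) + 1) = 0 := by
      rw [← Finset.sum_mul, sum_coeff, zero_mul]
    rw [← add_zero (∑ j, coeff Ext i s j * (a i * b (s, j))), ← hz, ← Finset.sum_add_distrib]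
    refine Finset.sum_congr rfl fun j _ => ?_
    rw [← hPQ i, hτPQ]
    simp only [Pi.zero_apply, Finset.sum_const_zero, zero_div]
    field_simp
    ring
  rw [e]
  calc _ ≤ 2 * N * (2 ^ d * Err Ext (k - 1) + 2 ^ d * Err Ext (k - 1)
        + 2 ^ d * Err Ext (k - 1)) := by gcongr
    _ = _ := by ring

/-! ### Bounds on the relaxation -/

/-- A real positive semidefinite matrix is a Gram matrix. -/
theorem exists_inner_eq_of_posSemidef {ι : Type*} [Finite ι] {M : Matrix ι ι ℝ}
    (hM : M.PosSemidef) :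
    ∃ (r : ℕ) (v : ι → EuclideanSpace ℝ (Fin r)), ∀ w w', M w w' = inner ℝ (v w) (v w') := by
  obtain ⟨r, u, rfl⟩ := Matrix.posSemidef_iff_eq_sum_vecMulVec.1 hM
  refine ⟨r, fun w => WithLp.toLp 2 fun e => u e w, fun w w' => ?_⟩
  rw [PiLp.inner_apply]
  simp [Matrix.sum_apply, Matrix.vecMulVec_apply, mul_comm]

namespace SdpFeasible

variable {k : ℝ} {Ω : Matrix (Word n m d) (Word n m d) ℝ}

theorem symm (h : SdpFeasible k Ω) (w w' : Word n m d) : Ω w w' = Ω w' w := by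
  simpa using h.posSemidef.isHermitian.apply w' w

theorem in_in_le (h : SdpFeasible k Ω) (i : Fin (2 ^ n)) :
    Ω (inW i) (inW i) ≤ ((2 : ℝ) ^ (-k)) ^ 2 := by
  have h1 := h.in_le i emptyW
  rw [h.empty_empty, mul_one, h.symm] at h1
  rw [sq]
  exact (h.in_le i (inW i)).trans (mul_le_mul_of_nonneg_left h1 (by positivity))

theorem test_test_le (h : SdpFeasible k Ω) (s : Fin (2 ^ d)) (j : Fin (2 ^ m)) :
    Ω (testW s j) (testW s j) ≤ 1 := by
  have h1 := h.test_le s j emptyW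
  rw [h.empty_empty, h.symm] at h1
  exact (h.test_le s j (testW s j)).trans h1

/-- The collision bound: `∑_{s,j} ‖∑ᵢ coeff i s j • aᵢ‖²` for Gram vectors `aᵢ`. -/
theorem sum_coeff_mul_coeff_le (h : SdpFeasible k Ω) (Ext : Extractor n m d) :
    ∑ s, ∑ j, ∑ i, ∑ i', coeff Ext i s j * coeff Ext i' s j * Ω (inW i) (inW i')
      ≤ 2 ^ d * Err Ext k := by
  have e : ∑ s, ∑ j, ∑ i, ∑ i', coeff Ext i s j * coeff Ext i' s j * Ω (inW i) (inW i')
      = ∑ i, bilinForm Ext (fun i' => Ω (inW i') (inW i))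
          (fun sj => if Ext sj.1 i = sj.2 then 1 else 0) := by
    calc _ = ∑ i, ∑ i', ∑ s, ∑ j,
          coeff Ext i s j * coeff Ext i' s j * Ω (inW i) (inW i') := by
          simp only [Finset.sum_comm (s := (Finset.univ : Finset (Fin (2 ^ m))))
            (t := (Finset.univ : Finset (Fin (2 ^ n))))]
          rw [Finset.sum_comm]
          exact Finset.sum_congr rfl fun i _ => Finset.sum_comm
      _ = _ := by
          refine Finset.sum_congr rfl fun i _ => Finset.sum_congr rfl fun i' _ =>
            Finset.sum_congr rfl fun s _ => ?_
          -- The constant part of `coeff Ext i s j` drops out, leaving the 0/1 indicator as test.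
          have hz : ∑ j, coeff Ext i' s j * (-(1 / 2 ^ m) * Ω (inW i) (inW i')) = 0 := by
            rw [← Finset.sum_mul, sum_coeff, zero_mul]
          refine sub_eq_zero.1 (Eq.trans ?_ hz)
          rw [← Finset.sum_sub_distrib]
          refine Finset.sum_congr rfl fun j _ => ?_
          beta_reduce
          rw [h.symm (inW i') (inW i)]
          conv_lhs => rw [coeff]
          ring
  rw [e]
  calc _ ≤ ∑ i, Ω (inW i) emptyW * (2 ^ d * Err Ext k) := by
        refine Finset.sum_le_sum fun i _ => ?_
        rw [h.symm (inW i) emptyW]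
        refine bilinForm_le_mul Ext (fun _ => h.nonneg _ _) (fun i' => h.in_le i' _)
          (h.empty_eq_sum _).symm (fun sj => ?_) (fun sj => ?_) <;>
        split_ifs <;> norm_num
    _ = 2 ^ d * Err Ext k := by
        rw [← Finset.sum_mul, ← h.empty_eq_sum, h.empty_empty, one_mul]

/-- Cauchy–Schwarz is used twice: against each test vector, then over the `2^(d+m)` pairs `(s, j)`.
-/
theorem sdpObjective_le_sqrt (h : SdpFeasible k Ω) (Ext : Extractor n m d) :
    sdpObjective Ext Ω ≤ √((2 : ℝ) ^ m * Err Ext k) := by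
  obtain ⟨r, v, hv⟩ := exists_inner_eq_of_posSemidef h.posSemidef
  let c : Fin (2 ^ d) × Fin (2 ^ m) → EuclideanSpace ℝ (Fin r) :=
    fun sj => ∑ i, coeff Ext i sj.1 sj.2 • v (inW i)
  have hobj : 2 ^ d * sdpObjective Ext Ω = ∑ sj, inner ℝ (c sj) (v (testW sj.1 sj.2)) := by
    simp only [c, sum_inner, real_inner_smul_left, ← hv]
    rw [Finset.sum_comm]
    simp only [Fintype.sum_prod_type, sdpObjective]
    field_simp
  have hle : 2 ^ d * sdpObjective Ext Ω ≤ ∑ sj, ‖c sj‖ := by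
    rw [hobj]
    refine Finset.sum_le_sum fun sj _ => (real_inner_le_norm _ _).trans
      (mul_le_of_le_one_right (norm_nonneg _) ?_)
    rw [← sq_le_one_iff₀ (norm_nonneg _), ← real_inner_self_eq_norm_sq, ← hv]
    exact h.test_test_le _ _
  have hsq : ∑ sj, ‖c sj‖ ^ 2 ≤ 2 ^ d * Err Ext k := by
    refine le_trans (le_of_eq ?_) (h.sum_coeff_mul_coeff_le Ext)
    rw [Fintype.sum_prod_type]
    refine Finset.sum_congr rfl fun s _ => Finset.sum_congr rfl fun j _ => ?_
    simp only [← real_inner_self_eq_norm_sq, c, sum_inner, inner_sum, real_inner_smul_left,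
      real_inner_smul_right, ← hv, mul_assoc]
    refine Finset.sum_congr rfl fun i _ => Finset.sum_congr rfl fun i' _ => ?_
    rw [h.symm (inW i)]
  have hcs : (∑ sj, ‖c sj‖) ^ 2 ≤ 2 ^ d * 2 ^ m * ∑ sj, ‖c sj‖ ^ 2 := by
    simpa using sq_sum_le_card_mul_sum_sq (s := Finset.univ) (f := fun sj => ‖c sj‖)
  have hroot : ∑ sj, ‖c sj‖ ≤ 2 ^ d * √((2 : ℝ) ^ m * Err Ext k) := by
    calc ∑ sj, ‖c sj‖ ≤ √((2 ^ d) ^ 2 * ((2 : ℝ) ^ m * Err Ext k)) := by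
          refine Real.le_sqrt_of_sq_le (hcs.trans ?_)
          calc _ ≤ 2 ^ d * 2 ^ m * (2 ^ d * Err Ext k) := by gcongr
            _ = _ := by ring
      _ = _ := by rw [Real.sqrt_mul (by positivity), Real.sqrt_sq (by positivity)]
  exact le_of_mul_le_mul_left (hle.trans hroot) (by positivity)

theorem sdpObjective_le_grothendieckConstant_mul (h : SdpFeasible k Ω) (Ext : Extractor n m d)
    (hk : k ≤ n) :
    sdpObjective Ext Ω
      ≤ 6 * grothendieckConstant * (2 : ℝ) ^ ((n : ℝ) - k) * Err Ext (k - 1) := by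
  obtain ⟨r, v, hv⟩ := exists_inner_eq_of_posSemidef h.posSemidef
  set κ : ℝ := (2 : ℝ) ^ (-k) with hκ
  have hκ0 : 0 < κ := by positivity
  -- Rescaling by `κ⁻¹` puts the vectors of the words `(i)` in the unit ball; the factor `κ`
  -- returned in `e` turns `2^n` into `2^(n-k)`.
  have key := sum_inner_le_of_forall_sum_le
    (fun i (sj : Fin (2 ^ d) × Fin (2 ^ m)) => coeff Ext i sj.1 sj.2)
    (fun i => κ⁻¹ • v (inW i)) (fun sj => v (testW sj.1 sj.2))
    (fun i => by
      rw [norm_smul, Real.norm_of_nonneg (by positivity), inv_mul_le_one₀ hκ0,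
        ← sq_le_sq₀ (norm_nonneg _) hκ0.le, ← real_inner_self_eq_norm_sq, ← hv]
      exact h.in_in_le i)
    (fun sj => by
      rw [← sq_le_one_iff₀ (norm_nonneg _), ← real_inner_self_eq_norm_sq, ← hv]
      exact h.test_test_le _ _)
    (B := 6 * 2 ^ n * (2 ^ d * Err Ext (k - 1)))
    (fun a b ha hb => by
      simp only [Fintype.sum_prod_type]
      exact bilinForm_le_of_abs_le_one Ext hk a b ha hb)
  have e : sdpObjective Ext Ω = κ / 2 ^ d * ∑ i, ∑ sj : Fin (2 ^ d) × Fin (2 ^ m),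
      coeff Ext i sj.1 sj.2 * inner ℝ (κ⁻¹ • v (inW i)) (v (testW sj.1 sj.2)) := by
    simp only [Fintype.sum_prod_type, real_inner_smul_left, ← hv, sdpObjective, Finset.mul_sum]
    refine Finset.sum_congr rfl fun i _ => Finset.sum_congr rfl fun s _ =>
      Finset.sum_congr rfl fun j _ => ?_
    field_simp
  have hpow : (2 : ℝ) ^ ((n : ℝ) - k) = 2 ^ n * κ := by
    rw [sub_eq_add_neg, Real.rpow_add two_pos, Real.rpow_natCast]
  rw [e, hpow]
  calc _ ≤ κ / 2 ^ d * (grothendieckConstant * (6 * 2 ^ n * (2 ^ d * Err Ext (k - 1)))) := by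
        gcongr
    _ = _ := by field_simp

end SdpFeasible

end QProofExtractor

theorem mainTheorem3 (n m d : ℕ) (Ext : QProofExtractor.Extractor n m d)
    (k : ℝ) (hk : k ≤ n) :
    QProofExtractor.ErrSdp Ext k
        ≤ √2 * √((2 : ℝ) ^ m) * √(QProofExtractor.Err Ext k) ∧
      QProofExtractor.ErrSdp Ext k
        ≤ 6 * QProofExtractor.grothendieckConstant * (2 : ℝ) ^ ((n : ℝ) - k)
            * QProofExtractor.Err Ext (k - 1) := by
  constructor
  · refine csSup_le (QProofExtractor.sdpValues_nonempty Ext hk) ?_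
    rintro t ⟨Ω, h, rfl⟩
    refine (h.sdpObjective_le_sqrt Ext).trans ?_
    rw [Real.sqrt_mul (by positivity), mul_assoc]
    -- The factor `√2` is slack: the bound already holds without it.
    exact le_mul_of_one_le_left (by positivity) (Real.one_le_sqrt.2 one_le_two)
  · refine csSup_le (QProofExtractor.sdpValues_nonempty Ext hk) ?_
    rintro t ⟨Ω, h, rfl⟩
    exact h.sdpObjective_le_grothendieckConstant_mul Ext hk
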